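/- Let $\mathcal I$ be a finite non-empty set of $I$ cells and let $\mathbf A$ be a $0$-$1$ matrix of full row rank whose columns are indexed by $\mathcal I$, with at least one $1$ in every column. The relational model for intensities generated by $\mathbf A$ is $$RM_{\boldsymbol\lambda}(\mathbf A)=\{\boldsymbol\lambda\in\mathbb R_{>0}^{I}:\ \log\boldsymbol\lambda=\mathbf A'\boldsymbol\theta\ \text{ for some real vector }\boldsymbol\theta\}.$$ For $\boldsymbol y\in\mathbb Z_{\ge 0}^{I}$, the maximum likelihood estimate (MLE) $\hat{\boldsymbol\lambda}(\boldsymbol y)$ is the maximizer over $RM_{\boldsymbol\lambda}(\mathbf A)$ of the Poisson log-likelihood $\boldsymbol\lambda\mapsto\sum_i y_i\log\lambda_i-\sum_i\lambda_i$; it is unique when it exists. Let $\mathscr E\subseteq\mathbb Z_{\ge0}^I$ be the set of those $\boldsymbol y$ for which it exists. The augmented MLE is $\tilde{\boldsymbol\lambda}(\boldsymbol y)=\hat{\boldsymbol\lambda}(\boldsymbol y)$ if $\boldsymbol y\in\mathscr E$, and the vector all of whose components are $\frac1I\sum_i y_i$ otherwise. Put $$X^2(\boldsymbol u,\boldsymbol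 v)=\sum_{i}\frac{(u_i-v_i)^2}{v_i},\qquad B(\boldsymbol u,\boldsymbol v)=2\sum_{i}\Bigl\{u_i\log\frac{u_i}{v_i}-(u_i-v_i)\Bigr\},$$ with the conventions that $0\log 0=0$ and that both statistics are $0$ when $\boldsymbol u=\boldsymbol v=\boldsymbol 0$. Let $\boldsymbol\lambda^{r}\in RM_{\boldsymbol\lambda}(\mathbf A)$, $r\in\mathbb N$, be a sequence with $\min_i\lambda^{r}_i\to\infty$ as $r\to\infty$, and for each $r$ let $\boldsymbol Y^{r}=(Y^r_i)_{i\in\mathcal I}$ be a random vector, defined on a probability space that may depend on $r$, with jointly independent components $Y^r_i\sim Pois(\lambda^r_i)$. Let $K=\dim \mathrm{Ker}(\mathbf A)$, and let $\chi^2_K$ be the chi-squared distribution with $K$ degrees of freedom (the unit mass at $0$ if $K=0$). Then $\mathbb P(\boldsymbol Y^r\in\mathscr E)>0$ for every $r$ and, as $r\to\infty$, each of the four laws $$\mathcal L\bigl(X^2(\boldsymbol Y^r,\hat{\boldsymbol\lambda}(\boldsymbol Y^r))\mid \boldsymbol Y^r\in\mathscr E\bigr),\quad \mathcal L\bigl(B(\boldsymbol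 Y^r,\hat{\boldsymbol\lambda}(\boldsymbol Y^r))\mid \boldsymbol Y^r\in\mathscr E\bigr),\quad \mathcal L\bigl(X^2(\boldsymbol Y^r,\tilde{\boldsymbol\lambda}(\boldsymbol Y^r))\bigr),\quad \mathcal L\bigl(B(\boldsymbol Y^r,\tilde{\boldsymbol\lambda}(\boldsymbol Y^r))\bigr)$$ converges weakly to $\chi^2_K$. -/

import Mathlib

open MeasureTheory ProbabilityTheory Filter Topology

noncomputable section

namespace RelationalModel

variable {I J : Type*} [Fintype I] [Fintype J]

/-- A design matrix of a relational model: a 0-1 matrix (rows: effects, columns: cells) of full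
row rank, with at least one 1 in every column. -/
structure IsDesignMatrix (A : Matrix J I ℝ) : Prop where
  zero_or_one : ∀ j i, A j i = 0 ∨ A j i = 1
  full_row_rank : LinearIndependent ℝ A.row
  exists_one : ∀ i, ∃ j, A j i = 1

/-- The relational model for intensities generated by `A`: the vectors `l > 0` such that
`log l = Aᵀ θ` for some parameter vector `θ`. -/
def model (A : Matrix J I ℝ) : Set (I → ℝ) :=
  {l | (∀ i, 0 < l i) ∧ ∃ θ : J → ℝ, ∀ i, Real.log (l i) = (A.transpose.mulVec θ) i}

/-- `Y` has the multivariate Poisson distribution with intensities `l > 0` under `P`: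
its components are jointly independent and `Y i` is Poisson with parameter `l i`. -/
structure IsPoissonVector {Ω : Type*} [MeasurableSpace Ω] (Y : Ω → I → ℕ) (l : I → ℝ)
    (P : Measure Ω) : Prop where
  hasLaw : ∀ i, HasLaw (fun ω => Y ω i) (poissonMeasure (l i).toNNReal) P
  indep : iIndepFun (fun i ω => Y ω i) P

/-- The Poisson log-likelihood of the intensities `l` for the data `y`, up to the additive term
`-∑ i, log (y i)!`, which does not depend on `l`. -/
def logLikelihood (l : I → ℝ) (y : I → ℕ) : ℝ :=
  ∑ i, (y i : ℝ) * Real.log (l i) - ∑ i, l i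

/-- `l` is a maximum likelihood estimate under the model generated by `A` for the data `y`. -/
def IsMLE (A : Matrix J I ℝ) (y : I → ℕ) (l : I → ℝ) : Prop :=
  l ∈ model A ∧ ∀ m ∈ model A, logLikelihood m y ≤ logLikelihood l y

/-- The set of data for which the maximum likelihood estimate exists. -/
def mleExists (A : Matrix J I ℝ) : Set (I → ℕ) :=
  {y | ∃ l, IsMLE A y l}

/-- The maximum likelihood estimate is unique when it exists. -/
theorem IsMLE.unique {A : Matrix J I ℝ} {y : I → ℕ} {l m : I → ℝ}
    (hl : IsMLE A y l) (hm : IsMLE A y m) : l = m := by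
  obtain ⟨⟨hlp, θ, hθ⟩, hlmax⟩ := hl
  obtain ⟨⟨hmp, η, hη⟩, hmmax⟩ := hm
  -- the cellwise geometric mean belongs to the model
  have hg : (fun i => Real.sqrt (l i * m i)) ∈ model A := by
    refine ⟨fun i => Real.sqrt_pos.2 (mul_pos (hlp i) (hmp i)), (2⁻¹ : ℝ) • (θ + η), fun i => ?_⟩
    rw [Matrix.mulVec_smul, Matrix.mulVec_add, Real.log_sqrt (mul_pos (hlp i) (hmp i)).le,
      Real.log_mul (hlp i).ne' (hmp i).ne', hθ i, hη i]
    simp only [Pi.smul_apply, Pi.add_apply, smul_eq_mul]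
    ring
  have h1 := hlmax _ hg
  have h2 := hmmax _ hg
  have key : 2 * logLikelihood (fun i => Real.sqrt (l i * m i)) y
      = logLikelihood l y + logLikelihood m y
        + ∑ i, (Real.sqrt (l i) - Real.sqrt (m i)) ^ 2 := by
    have e1 : ∑ i, (y i : ℝ) * Real.log (Real.sqrt (l i * m i))
        = (∑ i, (y i : ℝ) * Real.log (l i) + ∑ i, (y i : ℝ) * Real.log (m i)) / 2 := by
      rw [← Finset.sum_add_distrib, Finset.sum_div]
      refine Finset.sum_congr rfl fun i _ => ?_
      rw [Real.log_sqrt (mul_pos (hlp i) (hmp i)).le, Real.log_mul (hlp i).ne' (hmp i).ne']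
      ring
    have e2 : ∑ i, (Real.sqrt (l i) - Real.sqrt (m i)) ^ 2
        = ∑ i, l i + ∑ i, m i - 2 * ∑ i, Real.sqrt (l i * m i) := by
      rw [← Finset.sum_add_distrib, Finset.mul_sum, ← Finset.sum_sub_distrib]
      refine Finset.sum_congr rfl fun i _ => ?_
      rw [Real.sqrt_mul (hlp i).le]
      have a := Real.sq_sqrt (hlp i).le
      have b := Real.sq_sqrt (hmp i).le
      linear_combination a + b
    rw [e2]
    simp only [logLikelihood, e1]
    ring
  have h0 : ∑ i, (Real.sqrt (l i) - Real.sqrt (m i)) ^ 2 ≤ 0 := by linarith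
  have h3 := (Finset.sum_eq_zero_iff_of_nonneg (fun i _ => sq_nonneg
    (Real.sqrt (l i) - Real.sqrt (m i)))).1
    (le_antisymm h0 (Finset.sum_nonneg fun i _ => sq_nonneg _))
  funext i
  have h4 := h3 i (Finset.mem_univ i)
  have h5 : Real.sqrt (l i) = Real.sqrt (m i) := sub_eq_zero.1 (pow_eq_zero_iff two_ne_zero |>.1 h4)
  exact (Real.sqrt_inj (hlp i).le (hmp i).le).1 h5

open Classical in
/-- The maximum likelihood estimate under the model generated by `A`; it is meant for data in
`mleExists A` only, and has the value `0` otherwise. -/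
def mle (A : Matrix J I ℝ) (y : I → ℕ) : I → ℝ :=
  if h : y ∈ mleExists A then Classical.choose h else 0

theorem isMLE_iff_eq_mle {A : Matrix J I ℝ} {y : I → ℕ} (h : y ∈ mleExists A) (l : I → ℝ) :
    IsMLE A y l ↔ l = mle A y := by
  have hs : IsMLE A y (mle A y) := by
    rw [mle, dif_pos h]
    exact Classical.choose_spec h
  exact ⟨fun hl => hl.unique hs, fun hl => hl ▸ hs⟩

open Classical in
/-- The augmented maximum likelihood estimate: the maximum likelihood estimate when it exists,
and the vector with all components equal to the mean of the data otherwise. -/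
def augmentedMLE (A : Matrix J I ℝ) (y : I → ℕ) : I → ℝ :=
  if y ∈ mleExists A then mle A y else fun _ => (∑ i, (y i : ℝ)) / Fintype.card I

/-- The Pearson statistic. -/
def pearson (u v : I → ℝ) : ℝ :=
  ∑ i, (u i - v i) ^ 2 / v i

/-- The Bregman statistic (`0 * log 0 = 0`). -/
def bregman (u v : I → ℝ) : ℝ :=
  2 * ∑ i, (u i * Real.log (u i / v i) - (u i - v i))

/-- The chi-squared distribution with `K` degrees of freedom: the law of the sum of squares of `K`
independent standard normal variables (for `K = 0`, the unit mass at `0`). -/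
def chiSquared (K : ℕ) : Measure ℝ :=
  (Measure.pi fun _ : Fin K => gaussianReal 0 1).map fun z => ∑ k, z k ^ 2

instance (K : ℕ) : IsProbabilityMeasure (chiSquared K) :=
  Measure.isProbabilityMeasure_map
    (Measurable.aemeasurable (by fun_prop))

end RelationalModel

end

namespace RelationalModel

variable {I J : Type*} [Fintype I] [Fintype J]

/-! Put `w i = (y i - l i) / √(l i)`. In these coordinates the log-likelihood near `l` is quadratic
up to errors that vanish as the intensities grow, and the model is to first order the linear space
`tangent A l`. The MLE then corresponds to the projection of `w` onto this space, and both
statistics are close to the squared length of the residual, that is of the projection of `w` onto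
the normal space, of dimension `K`. `exists_isMLE_near` and `statistics_near_normalSq` make this
deterministic and quantitative for bounded `w`.

The normal space turns with `r` and need not converge, so a limit law for `w` alone is not applied.
Instead `tendsto_charFun_standardize` lets the frequency vary on a sphere: the Gaussian limit
depends only on its norm. In orthonormal bases of the normal spaces the projections therefore
converge to a standard Gaussian vector in dimension `K`, whose squared norm is chi-squared. The same
limits give tightness, so the deterministic estimates hold with probability tending to one.
Slutsky's theorem transfers the limit to the augmented statistics. Conditioning on existence of the
MLE, an event of probability tending to one, does not change it. -/

/-! ### Likelihood equations and existence of the MLE -/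

/-- The constant data `1` have a maximum likelihood estimate. -/
theorem one_mem_mleExists (A : Matrix J I ℝ) : (fun _ => 1) ∈ mleExists A := by
  refine ⟨fun _ => 1, ⟨fun _ => one_pos, 0, fun i => by simp⟩, fun m hm => ?_⟩
  simp only [logLikelihood, Nat.cast_one, one_mul, ← Finset.sum_sub_distrib]
  refine Finset.sum_le_sum fun i _ => ?_
  have := Real.log_le_sub_one_of_pos (hm.1 i)
  simp only [Real.log_one]
  linarith

omit [Fintype I] in
/-- Multiplying the cells of an element of the model by the exponential of a vector in the row
space stays in the model. -/
theorem mul_exp_mem_model {A : Matrix J I ℝ} {l : I → ℝ} (hl : l ∈ model A) (η : J → ℝ) :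
    (fun i => l i * Real.exp ((A.transpose.mulVec η) i)) ∈ model A := by
  obtain ⟨hp, θ, hθ⟩ := hl
  refine ⟨fun i => mul_pos (hp i) (Real.exp_pos _), θ + η, fun i => ?_⟩
  rw [Real.log_mul (hp i).ne' (Real.exp_pos _).ne', Real.log_exp, hθ, Matrix.mulVec_add]
  rfl

/-- The likelihood equations. -/
theorem IsMLE.sum_sub_mul_eq_zero {A : Matrix J I ℝ} {y : I → ℕ} {l : I → ℝ} (h : IsMLE A y l)
    (η : J → ℝ) : ∑ i, ((y i : ℝ) - l i) * (A.transpose.mulVec η) i = 0 := by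
  set v := A.transpose.mulVec η with hv
  -- Up to a constant this is the log-likelihood along the curve `l * exp (t v)`, which stays in the
  -- model and passes through the maximizer at `t = 0`.
  have hd : HasDerivAt (fun t : ℝ => ∑ i, ((y i : ℝ) * (Real.log (l i) + t * v i)
      - l i * Real.exp (t * v i))) (∑ i, ((y i : ℝ) * v i - l i * v i)) 0 := by
    refine HasDerivAt.fun_sum fun i _ => ?_
    have h1 : HasDerivAt (fun t : ℝ => t * v i) (v i) 0 := by
      simpa using (hasDerivAt_id (0 : ℝ)).mul_const (v i)
    have h2 := ((h1.const_add (Real.log (l i))).const_mul (y i : ℝ)).fun_sub (h1.exp.const_mul (l i))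
    simpa using h2
  have hmax : IsLocalMax (fun t : ℝ => ∑ i, ((y i : ℝ) * (Real.log (l i) + t * v i)
      - l i * Real.exp (t * v i))) 0 := by
    refine Eventually.of_forall fun t => ?_
    have h1 := h.2 _ (mul_exp_mem_model h.1 (t • η))
    simp only [logLikelihood, Matrix.mulVec_smul, ← hv, Pi.smul_apply, smul_eq_mul] at h1
    simp only [Finset.sum_sub_distrib, zero_mul, add_zero, Real.exp_zero, mul_one]
    refine le_trans (le_of_eq ?_) h1
    congr 1
    refine Finset.sum_congr rfl fun i _ => ?_
    rw [Real.log_mul (h.1.1 i).ne' (Real.exp_pos _).ne', Real.log_exp]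
  have h0 := hmax.hasDerivAt_eq_zero hd
  simpa [sub_mul] using h0

/-- A quadratic lower bound for the exponential remainder. -/
theorem sq_div_four_le_exp {x : ℝ} (hx : -2 ≤ x) : x ^ 2 / 4 ≤ Real.exp x - 1 - x := by
  -- Square `1 + x / 2 ≤ exp (x / 2)`, whose left side is nonnegative for `-2 ≤ x`.
  have h1 := Real.add_one_le_exp (x / 2)
  have h2 : Real.exp x = Real.exp (x / 2) ^ 2 := by
    rw [← Real.exp_nat_mul]; congr 1; push_cast; ring
  nlinarith

/-- If the data are at a bounded `χ²`-distance from a point `l` of the model with large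
intensities, then the maximum likelihood estimate exists and is near `l`. -/
theorem exists_isMLE_near {A : Matrix J I ℝ} {l : I → ℝ} (hl : l ∈ model A) {y : I → ℕ}
    {R : ℝ} (hR : 0 < R) (hy : ∑ i, ((y i : ℝ) - l i) ^ 2 / l i ≤ R ^ 2)
    (hL : ∀ i, 25 * R ^ 2 ≤ l i) :
    ∃ η : J → ℝ, IsMLE A y (fun i => l i * Real.exp ((A.transpose.mulVec η) i)) ∧
      ∑ i, l i * (A.transpose.mulVec η) i ^ 2 ≤ 25 * R ^ 2 := by
  have hp := hl.1
  -- Writing `m = l * exp x` turns the model into the linear space `V`. Here `G` is the negative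
  -- log-likelihood up to a constant, and `N` is the Fisher information form at `l`. Since `G` is
  -- convex and exceeds `G 0` on the sphere `N = 25 R²`, its minimum over the ball in `V` is global
  -- on `V`.
  set V : Submodule ℝ (I → ℝ) := LinearMap.range A.transpose.mulVecLin with hV
  set G : (I → ℝ) → ℝ := fun x => ∑ i, (l i * Real.exp (x i) - y i * x i) with hG
  set N : (I → ℝ) → ℝ := fun x => ∑ i, l i * x i ^ 2 with hN
  have hGc : Continuous G := by fun_prop
  have hNc : Continuous N := by fun_prop
  have hterm : ∀ x i, l i * x i ^ 2 ≤ N x := fun x i =>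
    Finset.single_le_sum (f := fun i => l i * x i ^ 2)
      (fun j _ => mul_nonneg (hp j).le (sq_nonneg _)) (Finset.mem_univ i)
  have hsmall : ∀ x, N x ≤ 25 * R ^ 2 → ∀ i, |x i| ≤ 1 := by
    intro x hx i
    have h1 := hterm x i
    have h2 : l i * x i ^ 2 ≤ l i * 1 := by linarith [hL i]
    have h3 := le_of_mul_le_mul_left h2 (hp i)
    exact (sq_le_one_iff_abs_le_one _).1 h3
  have hcomp : IsCompact ((V : Set (I → ℝ)) ∩ {x | N x ≤ 25 * R ^ 2}) := by
    refine Metric.isCompact_of_isClosed_isBounded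
      (V.closed_of_finiteDimensional.inter (isClosed_le hNc continuous_const)) ?_
    refine (Metric.isBounded_closedBall (x := (0 : I → ℝ)) (r := 1)).subset fun x hx => ?_
    rw [mem_closedBall_zero_iff, pi_norm_le_iff_of_nonneg zero_le_one]
    exact fun i => hsmall x hx.2 i
  obtain ⟨x, ⟨hxV, hxN⟩, hxmin⟩ := hcomp.exists_isMinOn
    ⟨0, V.zero_mem, by simp only [Set.mem_ofPred_eq, hN]; simp; positivity⟩ hGc.continuousOn
  have hsphere : ∀ p, N p = 25 * R ^ 2 → G 0 < G p := by
    intro p hpN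
    have hb := hsmall p hpN.le
    -- The exponential remainder contributes `N p / 4`. By Young's inequality the linear term costs
    -- at most `N p / 8 + 2 R²`, and `25 / 8 > 2` leaves a positive gap.
    have h1 : ∑ i, (l i * p i ^ 2 / 8 - 2 * (((y i : ℝ) - l i) ^ 2 / l i)) ≤ G p - G 0 := by
      simp only [hG, ← Finset.sum_sub_distrib]
      refine Finset.sum_le_sum fun i _ => ?_
      have e1 := sq_div_four_le_exp (x := p i) (by have := abs_le.1 (hb i); linarith)
      have e2 := mul_le_mul_of_nonneg_left e1 (hp i).le
      have e3 : ((y i : ℝ) - l i) * p i ≤ l i * p i ^ 2 / 8 + 2 * (((y i : ℝ) - l i) ^ 2 / l i) := by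
        have : l i * p i ^ 2 / 8 + 2 * (((y i : ℝ) - l i) ^ 2 / l i) - ((y i : ℝ) - l i) * p i
            = (l i * p i - 4 * ((y i : ℝ) - l i)) ^ 2 / (8 * l i) := by
          have := (hp i).ne'
          field_simp; ring
        have h := div_nonneg (sq_nonneg (l i * p i - 4 * ((y i : ℝ) - l i)))
          (by have := hp i; positivity : 0 ≤ 8 * l i)
        linarith
      simp only [Pi.zero_apply, Real.exp_zero]
      nlinarith
    rw [Finset.sum_sub_distrib, ← Finset.sum_div, ← Finset.mul_sum] at h1
    have h2 : ∑ i, l i * p i ^ 2 = 25 * R ^ 2 := hpN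
    rw [h2] at h1
    nlinarith [sq_pos_of_pos hR]
  have hconv : ∀ (t : ℝ) (x : I → ℝ), 0 ≤ t → t ≤ 1 → G (t • x) ≤ (1 - t) * G 0 + t * G x := by
    intro t x h0 h1
    simp only [hG, Finset.mul_sum, ← Finset.sum_add_distrib]
    refine Finset.sum_le_sum fun i _ => ?_
    have h2 := convexOn_exp.2 (Set.mem_univ 0) (Set.mem_univ (x i)) (sub_nonneg.2 h1) h0
      (by ring)
    have h3 := mul_le_mul_of_nonneg_left h2 (hp i).le
    simp only [smul_eq_mul, Pi.smul_apply, Real.exp_zero, Pi.zero_apply, mul_zero, zero_add] at h3 ⊢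
    nlinarith
  have hglob : ∀ v ∈ V, G x ≤ G v := by
    intro v hv
    have hx0 : G x ≤ G 0 := hxmin
      ⟨V.zero_mem, by simp only [Set.mem_ofPred_eq, hN]; simp; positivity⟩
    by_cases hvN : N v ≤ 25 * R ^ 2
    · exact hxmin ⟨hv, hvN⟩
    · push Not at hvN
      have hNp : 0 < N v := lt_trans (by positivity) hvN
      -- Shrink `v` onto the sphere; convexity along the segment from `0` then gives `G 0 < G v`.
      set t := Real.sqrt (25 * R ^ 2 / N v) with ht
      have ht2 : t ^ 2 = 25 * R ^ 2 / N v := Real.sq_sqrt (by positivity)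
      have ht0 : 0 < t := Real.sqrt_pos.2 (by positivity)
      have ht1 : t ≤ 1 := by
        rw [ht, Real.sqrt_le_iff, one_pow, div_le_one hNp]
        exact ⟨zero_le_one, hvN.le⟩
      have h1 : N (t • v) = 25 * R ^ 2 := by
        have : N (t • v) = t ^ 2 * N v := by
          simp only [hN, Finset.mul_sum, Pi.smul_apply, smul_eq_mul]
          exact Finset.sum_congr rfl fun i _ => by ring
        rw [this, ht2, div_mul_cancel₀ _ hNp.ne']
      have h2 := hsphere _ h1
      have h3 := hconv t v ht0.le ht1
      have h4 : t * G 0 < t * G v := by linarith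
      exact hx0.trans (lt_of_mul_lt_mul_left h4 ht0.le).le
  obtain ⟨η, hη⟩ := hxV
  have hη' : A.transpose.mulVec η = x := hη
  refine ⟨η, ⟨mul_exp_mem_model hl η, fun m hm => ?_⟩, by rw [hη']; exact hxN⟩
  obtain ⟨-, θ₀, hθ₀⟩ := hl
  obtain ⟨hmp, θ, hθ⟩ := hm
  have h1 := hglob (A.transpose.mulVec (θ - θ₀)) ⟨θ - θ₀, rfl⟩
  have hLL : ∀ v : I → ℝ, logLikelihood (fun i => l i * Real.exp (v i)) y
      = ∑ i, (y i : ℝ) * Real.log (l i) - G v := by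
    intro v
    simp only [logLikelihood, hG, ← Finset.sum_sub_distrib]
    refine Finset.sum_congr rfl fun i _ => ?_
    rw [Real.log_mul (hp i).ne' (Real.exp_pos _).ne', Real.log_exp]
    ring
  have hm' : m = fun i => l i * Real.exp ((A.transpose.mulVec (θ - θ₀)) i) := by
    funext i
    rw [Matrix.mulVec_sub, Pi.sub_apply, ← hθ, ← hθ₀, Real.exp_sub, Real.exp_log (hmp i),
      Real.exp_log (hp i), mul_div_cancel₀ _ (hp i).ne']
  rw [hm', hη', hLL, hLL]
  linarith

/-! ### Tangent and normal spaces in standardized coordinates -/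

/-- The tangent space of the model at `l`, in the coordinates that standardize the Poisson
distribution with intensities `l`. -/
noncomputable def tangent (A : Matrix J I ℝ) (l : I → ℝ) : Submodule ℝ (EuclideanSpace ℝ I) :=
  LinearMap.range ((WithLp.linearEquiv 2 ℝ (I → ℝ)).symm.toLinearMap ∘ₗ
    (LinearMap.pi fun i => Real.sqrt (l i) • LinearMap.proj i) ∘ₗ A.transpose.mulVecLin)

/-- The standardized data. -/
noncomputable def standardize (l : I → ℝ) (y : I → ℕ) : EuclideanSpace ℝ I :=
  WithLp.toLp 2 fun i => ((y i : ℝ) - l i) / Real.sqrt (l i)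

omit [Fintype I] in
theorem mem_tangent (A : Matrix J I ℝ) (l : I → ℝ) (η : J → ℝ) :
    WithLp.toLp 2 (fun i => Real.sqrt (l i) * (A.transpose.mulVec η) i) ∈ tangent A l :=
  ⟨η, rfl⟩

/-- For `x i = (y i - m i) / √(l i)` the right-hand side is the system of likelihood equations at
`m`, so the scaled residual at the MLE is a normal vector. -/
theorem mem_tangent_orthogonal {A : Matrix J I ℝ} {l : I → ℝ} {x : EuclideanSpace ℝ I} :
    x ∈ (tangent A l)ᗮ ↔
      ∀ η : J → ℝ, ∑ i, Real.sqrt (l i) * (A.transpose.mulVec η) i * x i = 0 := by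
  have key : ∀ η : J → ℝ, inner ℝ (WithLp.toLp 2
      (fun i => Real.sqrt (l i) * (A.transpose.mulVec η) i) : EuclideanSpace ℝ I) x
      = ∑ i, Real.sqrt (l i) * (A.transpose.mulVec η) i * x i := by
    intro η
    rw [PiLp.inner_apply]
    exact Finset.sum_congr rfl fun i _ => by simp [mul_comm]
  rw [Submodule.mem_orthogonal]
  constructor
  · intro h η
    rw [← key]
    exact h _ (mem_tangent A l η)
  · rintro h _ ⟨η, rfl⟩
    have := h η
    rw [← key] at this
    exact this

/-- The normal space has the dimension of the kernel of the design matrix. -/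
theorem finrank_tangent_orthogonal {A : Matrix J I ℝ} {l : I → ℝ} (hl : ∀ i, 0 < l i) :
    Module.finrank ℝ (tangent A l)ᗮ = Module.finrank ℝ (LinearMap.ker A.mulVecLin) := by
  have hs : ∀ i, Real.sqrt (l i) ≠ 0 := fun i => (Real.sqrt_pos.2 (hl i)).ne'
  -- A vector `x` is normal exactly when `√l * x` lies in the kernel of `A`, so this invertible
  -- diagonal scaling matches the two spaces.
  let e : EuclideanSpace ℝ I ≃ₗ[ℝ] (I → ℝ) :=
    (WithLp.linearEquiv 2 ℝ (I → ℝ)).trans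
      (LinearEquiv.piCongrRight fun i => LinearEquiv.smulOfNeZero ℝ ℝ (Real.sqrt (l i)) (hs i))
  have he : ∀ x i, e x i = Real.sqrt (l i) * x i := fun x i => rfl
  have hmap : (tangent A l)ᗮ = (LinearMap.ker A.mulVecLin).comap e.toLinearMap := by
    ext x
    have hx : ∀ η : J → ℝ, ∑ i, Real.sqrt (l i) * (A.transpose.mulVec η) i * x i
        = A.mulVec (e x) ⬝ᵥ η := by
      intro η
      rw [dotProduct_comm, Matrix.dotProduct_mulVec, ← Matrix.mulVec_transpose]
      simp only [dotProduct, he]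
      exact Finset.sum_congr rfl fun i _ => by ring
    rw [mem_tangent_orthogonal]
    simp only [hx, Submodule.mem_comap, LinearMap.mem_ker, Matrix.mulVecLin_apply]
    exact dotProduct_eq_zero_iff
  rw [hmap]
  exact ((e.ofSubmodule' (LinearMap.ker A.mulVecLin))).finrank_eq

/-! ### Quadratic approximation of the two statistics -/

/-- For `u = v (1 + s)` the Bregman summand is `2 v ((1 + s) log (1 + s) - s)` and the Pearson
summand is `v s²`; a Taylor bound for the logarithm makes their difference cubic in `s`. -/
theorem abs_one_add_mul_log_sub_le {s : ℝ} (hs : |s| ≤ 1 / 2) :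
    |(1 + s) * Real.log (1 + s) - s - s ^ 2 / 2| ≤ 4 * |s| ^ 3 := by
  have h1 := Real.abs_log_sub_add_sum_range_le (x := -s) (by rw [abs_neg]; linarith) 2
  simp only [Finset.sum_range_succ, Finset.sum_range_zero, abs_neg, sub_neg_eq_add] at h1
  set r := s ^ 2 / 2 - s + Real.log (1 + s) with hr
  have h2 : |r| ≤ 2 * |s| ^ 3 := by
    have h3 : |s| ^ (2 + 1) / (1 - |s|) ≤ 2 * |s| ^ 3 := by
      rw [div_le_iff₀ (by linarith)]
      have : 0 ≤ |s| ^ 3 := by positivity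
      norm_num
      nlinarith
    refine le_trans (le_of_eq ?_) (h1.trans h3)
    congr 1
    rw [hr]; push_cast; ring
  have h4 : (1 + s) * Real.log (1 + s) - s - s ^ 2 / 2 = -s ^ 3 / 2 + (1 + s) * r := by
    rw [hr]; ring
  rw [h4]
  have h5 : |1 + s| ≤ 3 / 2 := by
    have := abs_le.1 hs
    rw [abs_le]; constructor <;> linarith
  calc |(-s ^ 3 / 2 + (1 + s) * r)| ≤ |(-s ^ 3 / 2)| + |(1 + s) * r| := abs_add_le _ _
    _ = |s| ^ 3 / 2 + |1 + s| * |r| := by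
      rw [abs_mul, abs_div, abs_neg, abs_pow, abs_of_pos (two_pos : (0 : ℝ) < 2)]
    _ ≤ |s| ^ 3 / 2 + 3 / 2 * (2 * |s| ^ 3) := by gcongr
    _ ≤ 4 * |s| ^ 3 := by
      have : 0 ≤ |s| ^ 3 := by positivity
      linarith

/-- The Bregman and the Pearson statistic are close when the relative residuals are small. -/
theorem abs_bregman_sub_pearson_le {u v : I → ℝ} (hv : ∀ i, 0 < v i) {ε : ℝ} (hε : ε ≤ 1 / 2)
    (h : ∀ i, |u i - v i| ≤ ε * v i) : |bregman u v - pearson u v| ≤ 8 * ε * pearson u v := by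
  simp only [bregman, pearson, Finset.mul_sum, ← Finset.sum_sub_distrib]
  refine (Finset.abs_sum_le_sum_abs _ _).trans (Finset.sum_le_sum fun i _ => ?_)
  have hv0 := (hv i).ne'
  set s := (u i - v i) / v i with hs
  have hsε : |s| ≤ ε := by
    rw [hs, abs_div, abs_of_pos (hv i), div_le_iff₀ (hv i)]
    exact h i
  have h1 := abs_one_add_mul_log_sub_le (hsε.trans hε)
  have hu : u i / v i = 1 + s := by rw [hs]; field_simp; ring
  have hu' : u i = v i * (1 + s) := by rw [← hu]; field_simp
  have e1 : 2 * (u i * Real.log (u i / v i) - (u i - v i)) - (u i - v i) ^ 2 / v i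
      = 2 * v i * ((1 + s) * Real.log (1 + s) - s - s ^ 2 / 2) := by
    rw [hu]; nth_rewrite 1 [hu']; rw [hs]; field_simp
  have e2 : (u i - v i) ^ 2 / v i = v i * |s| ^ 2 := by
    rw [sq_abs, hs]; field_simp
  rw [e1, e2, abs_mul, abs_of_pos (by have := hv i; positivity : 0 < 2 * v i)]
  calc 2 * v i * |(1 + s) * Real.log (1 + s) - s - s ^ 2 / 2|
      ≤ 2 * v i * (4 * |s| ^ 3) := by have := hv i; gcongr
    _ = 8 * |s| * (v i * |s| ^ 2) := by ring
    _ ≤ 8 * ε * (v i * |s| ^ 2) := by have := hv i; gcongr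

theorem norm_standardize_sq {l : I → ℝ} (hl : ∀ i, 0 < l i) (y : I → ℕ) :
    ‖standardize l y‖ ^ 2 = ∑ i, ((y i : ℝ) - l i) ^ 2 / l i := by
  rw [EuclideanSpace.norm_sq_eq]
  refine Finset.sum_congr rfl fun i _ => ?_
  simp only [standardize, Real.norm_eq_abs, sq_abs, div_pow, Real.sq_sqrt (hl i).le]

/-- The squared length of the component of the standardized data normal to the model. -/
noncomputable def normalSq (A : Matrix J I ℝ) (l : I → ℝ) (x : EuclideanSpace ℝ I) : ℝ :=
  ‖(tangent A l)ᗮ.starProjection x‖ ^ 2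

/-- If the standardized data are bounded and the intensities are large, then both statistics at
the maximum likelihood estimate are close to `normalSq`. -/
theorem statistics_near_normalSq {A : Matrix J I ℝ} {l : I → ℝ} (hl : l ∈ model A) {y : I → ℕ}
    {R δ : ℝ} (hR : 0 < R) (hδ0 : 0 < δ) (hδ : δ ≤ 1 / 50) (hy : ‖standardize l y‖ ≤ R)
    (hL : ∀ i, R ≤ δ * Real.sqrt (l i)) :
    y ∈ mleExists A ∧
    |pearson (fun i => (y i : ℝ)) (mle A y) - normalSq A l (standardize l y)|
      ≤ 1000 * R ^ 2 * δ ∧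
    |bregman (fun i => (y i : ℝ)) (mle A y) - normalSq A l (standardize l y)|
      ≤ 5000 * R ^ 2 * δ := by
  have hp := hl.1
  set s : I → ℝ := fun i => Real.sqrt (l i) with hs
  have hs0 : ∀ i, 0 < s i := fun i => Real.sqrt_pos.2 (hp i)
  have hs2 : ∀ i, s i ^ 2 = l i := fun i => Real.sq_sqrt (hp i).le
  have hlow : ∀ i, 25 * R ^ 2 ≤ l i := by
    intro i
    have h1 : 50 * R ≤ s i := by nlinarith [hL i, hs0 i]
    rw [← hs2]
    nlinarith
  obtain ⟨η, hmle, hN⟩ := exists_isMLE_near hl hR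
    (by rw [← norm_standardize_sq hp]; gcongr) hlow
  have hE : y ∈ mleExists A := ⟨_, hmle⟩
  refine ⟨hE, ?_⟩
  rw [← (isMLE_iff_eq_mle hE _).1 hmle]
  set x := A.transpose.mulVec η with hx
  set m : I → ℝ := fun i => l i * Real.exp (x i) with hm
  set w := standardize l y with hw
  have hwi : ∀ i, w i = ((y i : ℝ) - l i) / s i := fun i => rfl
  -- Decompose `w = p + z + r`: `z` is tangent, `p` is the residual at the MLE scaled by `√l` and is
  -- normal, and `r` is the second-order remainder of the exponential, of size `R δ`.
  set z : EuclideanSpace ℝ I := WithLp.toLp 2 fun i => s i * x i with hz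
  set p : EuclideanSpace ℝ I := WithLp.toLp 2 fun i => ((y i : ℝ) - m i) / s i with hpdef
  set r : EuclideanSpace ℝ I := WithLp.toLp 2 fun i => s i * (Real.exp (x i) - 1 - x i) with hr
  have hzn2 : ‖z‖ ^ 2 ≤ (5 * R) ^ 2 := by
    rw [EuclideanSpace.norm_sq_eq]
    refine le_trans (le_of_eq (Finset.sum_congr rfl fun i _ => ?_)) (hN.trans (le_of_eq (by ring)))
    simp only [hz, Real.norm_eq_abs, sq_abs, mul_pow, hs2]
  have hzn : ‖z‖ ≤ 5 * R := (sq_le_sq₀ (norm_nonneg _) (by positivity)).1 hzn2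
  have hxi : ∀ i, |x i| ≤ 5 * δ := by
    intro i
    have h1 : ‖z i‖ ≤ 5 * R := (PiLp.norm_apply_le z i).trans hzn
    have h2 : s i * |x i| ≤ s i * (5 * δ) := by
      have : ‖z i‖ = s i * |x i| := by
        simp only [hz, Real.norm_eq_abs, abs_mul, abs_of_pos (hs0 i)]
      have := hL i
      linarith
    exact le_of_mul_le_mul_left h2 (hs0 i)
  have hrn : ‖r‖ ≤ 25 * R * δ := by
    have h1 : ‖r‖ ^ 2 ≤ (5 * δ * ‖z‖) ^ 2 := by
      rw [mul_pow, EuclideanSpace.norm_sq_eq, EuclideanSpace.norm_sq_eq, Finset.mul_sum]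
      refine Finset.sum_le_sum fun i _ => ?_
      rw [← mul_pow]
      refine pow_le_pow_left₀ (norm_nonneg _) ?_ 2
      have h2 := Real.abs_exp_sub_one_sub_id_le (x := x i) (by linarith [hxi i])
      simp only [hr, hz, Real.norm_eq_abs, abs_mul, abs_of_pos (hs0 i)]
      calc s i * |Real.exp (x i) - 1 - x i| ≤ s i * (|x i| * |x i|) := by
            have := (hs0 i).le
            rw [← sq, sq_abs]; gcongr
        _ ≤ s i * (5 * δ * |x i|) := by
            have := (hs0 i).le
            have := hxi i
            gcongr
        _ = 5 * δ * (s i * |x i|) := by ring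
    have h2 := (sq_le_sq₀ (norm_nonneg _) (by positivity)).1 h1
    nlinarith
  have hwp : w = p + z + r := by
    ext i
    have := (hs0 i).ne'
    simp only [PiLp.add_apply, hwi, hpdef, hz, hr, hm]
    rw [← hs2]
    field_simp
    ring
  have hpn : ‖p‖ ≤ 7 * R := by
    have : p = w - z - r := by rw [hwp]; abel
    rw [this]
    refine (norm_sub_le _ _).trans ?_
    have := norm_sub_le w z
    nlinarith
  have hporth : p ∈ (tangent A l)ᗮ := by
    rw [mem_tangent_orthogonal]
    intro ξ
    rw [← hmle.sum_sub_mul_eq_zero ξ]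
    refine Finset.sum_congr rfl fun i _ => ?_
    have := (hs0 i).ne'
    simp only [hpdef]
    change s i * _ * (_ / s i) = _
    field_simp
  -- The normal projection fixes `p` and kills `z`, so `p` and `Q w` differ only by `Q r`.
  set Q := (tangent A l)ᗮ.starProjection with hQ
  have hQw : Q w = p + Q r := by
    rw [hwp, map_add, map_add, hQ, Submodule.starProjection_eq_self_iff.2 hporth,
      Submodule.starProjection_orthogonal_apply_eq_zero (mem_tangent A l η), add_zero]
  have hQr : ‖Q r‖ ≤ 25 * R * δ := (Submodule.norm_starProjection_apply_le _ _).trans hrn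
  have hQw' : ‖Q w‖ ≤ R := (Submodule.norm_starProjection_apply_le _ _).trans hy
  have hnear : |‖p‖ ^ 2 - normalSq A l w| ≤ 200 * R ^ 2 * δ := by
    have h1 : |‖p‖ - ‖Q w‖| ≤ 25 * R * δ := by
      refine (abs_norm_sub_norm_le p (Q w)).trans ?_
      rw [hQw, sub_add_cancel_left, norm_neg]
      exact hQr
    have h2 : ‖p‖ ^ 2 - normalSq A l w = (‖p‖ - ‖Q w‖) * (‖p‖ + ‖Q w‖) := by
      rw [normalSq]; ring
    rw [h2, abs_mul, abs_of_nonneg (by positivity : 0 ≤ ‖p‖ + ‖Q w‖)]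
    calc |‖p‖ - ‖Q w‖| * (‖p‖ + ‖Q w‖) ≤ 25 * R * δ * (7 * R + R) := by gcongr
      _ = 200 * R ^ 2 * δ := by ring
  have hpsq : ‖p‖ ^ 2 ≤ 49 * R ^ 2 := by
    have := pow_le_pow_left₀ (norm_nonneg p) hpn 2
    linarith
  -- Pearson's statistic divides by `m` where `‖p‖²` divides by `l`; the ratio is `exp (-x i)`,
  -- within `2 |x i| ≤ 10 δ` of `1`.
  have hpear : |pearson (fun i => (y i : ℝ)) m - ‖p‖ ^ 2| ≤ 10 * δ * ‖p‖ ^ 2 := by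
    rw [EuclideanSpace.norm_sq_eq, pearson, ← Finset.sum_sub_distrib, Finset.mul_sum]
    refine (Finset.abs_sum_le_sum_abs _ _).trans (Finset.sum_le_sum fun i _ => ?_)
    have h1 : ((y i : ℝ) - m i) ^ 2 / m i = ‖p i‖ ^ 2 * Real.exp (-x i) := by
      have := (hs0 i).ne'
      simp only [hpdef, Real.norm_eq_abs, sq_abs, div_pow, hs2, Real.exp_neg]
      simp only [hm]
      rw [div_mul_eq_div_div, div_eq_mul_inv (_ / _)]
    rw [h1, show ‖p i‖ ^ 2 * Real.exp (-x i) - ‖p i‖ ^ 2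
      = (Real.exp (-x i) - 1) * ‖p i‖ ^ 2 by ring, abs_mul, abs_of_nonneg (sq_nonneg ‖p i‖)]
    have h2 := Real.abs_exp_sub_one_le (x := -x i) (by rw [abs_neg]; linarith [hxi i])
    rw [abs_neg] at h2
    gcongr
    linarith [hxi i]
  have hpear' : |pearson (fun i => (y i : ℝ)) m - ‖p‖ ^ 2| ≤ 490 * R ^ 2 * δ := by
    refine hpear.trans ?_
    nlinarith
  have hmpos : ∀ i, 0 < m i := hmle.1.1
  -- The residual is at most `7 δ l`, and `l ≤ (10 / 9) m` because `5 δ ≤ 1 / 10`; since `7 ≤ 8 * 9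
  -- / 10`, the choice `ε = 8 δ` works.
  have hbreg := abs_bregman_sub_pearson_le (u := fun i => (y i : ℝ)) hmpos (ε := 8 * δ)
    (by linarith) (by
      intro i
      have h1 : ‖p i‖ ≤ 7 * R := (PiLp.norm_apply_le p i).trans hpn
      have h2 : |(y i : ℝ) - m i| = ‖p i‖ * s i := by
        have := (hs0 i).ne'
        simp only [hpdef, Real.norm_eq_abs, abs_div, abs_of_pos (hs0 i)]
        field_simp
      have h3 : (9 / 10 : ℝ) ≤ Real.exp (x i) := by
        have := Real.add_one_le_exp (x i)
        have := (abs_le.1 (hxi i)).1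
        linarith
      have hsi := hs0 i
      calc |(y i : ℝ) - m i| = ‖p i‖ * s i := h2
        _ ≤ 7 * (δ * s i) * s i := by
          have := hL i
          gcongr
          linarith
        _ ≤ 8 * δ * (s i ^ 2 * (9 / 10)) := by nlinarith [mul_pos hδ0 (pow_pos hsi 2)]
        _ ≤ 8 * δ * (s i ^ 2 * Real.exp (x i)) := by gcongr
        _ = 8 * δ * m i := by rw [hs2])
  have hpear60 : pearson (fun i => (y i : ℝ)) m ≤ 60 * R ^ 2 := by
    have := (abs_le.1 hpear').2
    nlinarith [sq_pos_of_pos hR]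
  have hRδ : 0 < R ^ 2 * δ := by positivity
  have htot : |pearson (fun i => (y i : ℝ)) m - normalSq A l w| ≤ 690 * R ^ 2 * δ :=
    (abs_sub_le _ (‖p‖ ^ 2) _).trans (by linarith)
  refine ⟨by linarith, ?_⟩
  refine (abs_sub_le _ (pearson (fun i => (y i : ℝ)) m) _).trans ?_
  have : 8 * (8 * δ) * pearson (fun i => (y i : ℝ)) m ≤ 8 * (8 * δ) * (60 * R ^ 2) := by gcongr
  linarith

/-! ### Characteristic functions and tightness of standardized Poisson vectors -/

theorem IsPoissonVector.aemeasurable {Ω : Type*} [MeasurableSpace Ω] {Y : Ω → I → ℕ} {l : I → ℝ}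
    {P : Measure Ω} (h : IsPoissonVector Y l P) : AEMeasurable Y P :=
  aemeasurable_pi_iff.2 fun i => (h.hasLaw i).aemeasurable

/-- The characteristic function of a standardized Poisson variable. -/
theorem charFun_standardized_poisson {Ω : Type*} [MeasurableSpace Ω] {X : Ω → ℕ} {l : ℝ}
    (hl : 0 < l) {P : Measure Ω} (h : HasLaw X (poissonMeasure l.toNNReal) P) (t : ℝ) :
    charFun (P.map fun ω => ((X ω : ℝ) - l) / Real.sqrt l) t
      = Complex.exp (l * (Complex.exp (t / Real.sqrt l * Complex.I) - 1)
        - t * Real.sqrt l * Complex.I) := by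
  have hm := h.aemeasurable
  have hs : (Real.sqrt l : ℂ) ≠ 0 := by exact_mod_cast (Real.sqrt_pos.2 hl).ne'
  have hs2 : (Real.sqrt l : ℂ) ^ 2 = l := by exact_mod_cast Real.sq_sqrt hl.le
  have hc : AEMeasurable (fun ω => ((X ω : ℝ))) P := measurable_from_nat.comp_aemeasurable hm
  have hY := charFun_map_cast_poissonMeasure l.toNNReal (t / Real.sqrt l)
  rw [Real.coe_toNNReal _ hl.le, ← h.map_eq,
    AEMeasurable.map_map_of_aemeasurable measurable_from_nat.aemeasurable hm, charFun_apply_real,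
    Function.comp_def, integral_map hc (by fun_prop)] at hY
  rw [charFun_apply_real, integral_map (by fun_prop) (by fun_prop), sub_eq_add_neg, Complex.exp_add,
    ← Complex.ofReal_div, ← hY, ← integral_mul_const]
  refine integral_congr_ae (Eventually.of_forall fun ω => ?_)
  simp only
  rw [← Complex.exp_add]
  congr 1
  push_cast
  rw [← hs2]
  field_simp
  ring

theorem charFun_standardize {Ω : Type*} [MeasurableSpace Ω] {Y : Ω → I → ℕ} {l : I → ℝ}
    (hl : ∀ i, 0 < l i) {P : Measure Ω} [IsProbabilityMeasure P] (h : IsPoissonVector Y l P)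
    (t : EuclideanSpace ℝ I) :
    charFun (P.map fun ω => standardize l (Y ω)) t
      = Complex.exp (∑ i, (l i * (Complex.exp (t i / Real.sqrt (l i) * Complex.I) - 1)
        - t i * Real.sqrt (l i) * Complex.I)) := by
  have hi : iIndepFun (fun i ω => ((Y ω i : ℝ) - l i) / Real.sqrt (l i)) P :=
    h.indep.comp (fun i (k : ℕ) => ((k : ℝ) - l i) / Real.sqrt (l i)) fun i => measurable_from_nat
  have hm : ∀ i, AEMeasurable (fun ω => ((Y ω i : ℝ) - l i) / Real.sqrt (l i)) P := fun i =>
    (measurable_from_nat (f := fun k : ℕ => ((k : ℝ) - l i) / Real.sqrt (l i))).comp_aemeasurable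
      (h.hasLaw i).aemeasurable
  have h1 := (iIndepFun_iff_charFun_pi hm).1 hi t
  rw [Complex.exp_sum]
  refine h1.trans (Finset.prod_congr rfl fun i _ => ?_)
  exact charFun_standardized_poisson (hl i) (h.hasLaw i) (t i)

/-- The exponent is `l (exp x - 1 - x)` with `x = i t / √l`. Its quadratic term is `-t² / 2`, and
the cubic remainder is of order `l * l^(-3/2)`. Uniformity in `|t| ≤ τ` is what allows the frequency
to vary with `r`. -/
theorem norm_poisson_exponent_add_le {l t τ : ℝ} (hl : 1 ≤ l) (ht : |t| ≤ τ) :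
    ‖(l * (Complex.exp (t / Real.sqrt l * Complex.I) - 1) - t * Real.sqrt l * Complex.I : ℂ)
      + t ^ 2 / 2‖ ≤ τ ^ 3 * Real.exp τ / Real.sqrt l := by
  have hl0 : 0 < l := by linarith
  have hs1 : 1 ≤ Real.sqrt l := Real.one_le_sqrt.2 hl
  have hs0 : 0 < Real.sqrt l := by linarith
  have hs : (Real.sqrt l : ℂ) ≠ 0 := by exact_mod_cast hs0.ne'
  have hs2' : Real.sqrt l ^ 2 = l := Real.sq_sqrt hl0.le
  have hs2 : (Real.sqrt l : ℂ) ^ 2 = l := by exact_mod_cast hs2'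
  set x : ℂ := t / Real.sqrt l * Complex.I with hx
  have hxn : ‖x‖ = |t| / Real.sqrt l := by
    rw [hx, norm_mul, Complex.norm_I, mul_one, norm_div, Complex.norm_real, Complex.norm_real,
      Real.norm_eq_abs, Real.norm_eq_abs, abs_of_pos hs0]
  have h1 := Complex.norm_exp_sub_sum_le_norm_mul_exp x 3
  have h2 : (l * (Complex.exp x - 1) - t * Real.sqrt l * Complex.I : ℂ) + t ^ 2 / 2
      = l * (Complex.exp x - ∑ m ∈ Finset.range 3, x ^ m / (m.factorial : ℂ)) := by
    have hx2 : (l : ℂ) * x ^ 2 = - t ^ 2 := by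
      rw [hx, mul_pow, Complex.I_sq, div_pow, hs2]
      have : (l : ℂ) ≠ 0 := by exact_mod_cast hl0.ne'
      field_simp
    have hx1 : (l : ℂ) * x = t * Real.sqrt l * Complex.I := by
      rw [hx, ← hs2]; field_simp
    simp only [Finset.sum_range_succ, Finset.sum_range_zero, Nat.factorial]
    push_cast
    linear_combination hx1 + hx2 / 2
  rw [h2, norm_mul, Complex.norm_real, Real.norm_eq_abs, abs_of_pos hl0]
  have hτ : 0 ≤ τ := (abs_nonneg t).trans ht
  calc l * ‖Complex.exp x - ∑ m ∈ Finset.range 3, x ^ m / (m.factorial : ℂ)‖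
      ≤ l * (‖x‖ ^ 3 * Real.exp ‖x‖) := by gcongr
    _ ≤ l * ((τ / Real.sqrt l) ^ 3 * Real.exp τ) := by
      have h3 : ‖x‖ ≤ τ / Real.sqrt l := by rw [hxn]; gcongr
      have h4 : ‖x‖ ≤ τ := h3.trans (div_le_self hτ hs1)
      gcongr
    _ = τ ^ 3 * Real.exp τ / Real.sqrt l := by
      nth_rewrite 1 [← hs2']
      field_simp

/-- The characteristic functions of standardized Poisson vectors with intensities tending to
infinity converge to the Gaussian one along sequences on a sphere. -/
theorem tendsto_charFun_standardize [Nonempty I] {Ω : ℕ → Type*} [∀ r, MeasurableSpace (Ω r)]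
    {P : ∀ r, Measure (Ω r)} [∀ r, IsProbabilityMeasure (P r)] {l : ℕ → I → ℝ}
    (hl : ∀ r i, 0 < l r i) (hmin : Tendsto (fun r => ⨅ i, l r i) atTop atTop)
    {Y : ∀ r, Ω r → I → ℕ} (hY : ∀ r, IsPoissonVector (Y r) (l r) (P r))
    {t : ℕ → EuclideanSpace ℝ I} {τ : ℝ} (ht : ∀ r, ‖t r‖ = τ) :
    Tendsto (fun r => charFun ((P r).map fun ω => standardize (l r) (Y r ω)) (t r)) atTop
      (𝓝 (Complex.exp (-(τ ^ 2 / 2 : ℝ)))) := by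
  simp only [charFun_standardize (hl _) (hY _)]
  refine (Complex.continuous_exp.tendsto _).comp ?_
  have hli : ∀ i, Tendsto (fun r => l r i) atTop atTop := fun i =>
    tendsto_atTop_mono (fun r => ciInf_le (Set.finite_range _).bddBelow i) hmin
  rw [tendsto_iff_norm_sub_tendsto_zero]
  have hsum : Tendsto (fun r => ∑ i, τ ^ 3 * Real.exp τ / Real.sqrt (l r i)) atTop (𝓝 0) := by
    rw [← Finset.sum_const_zero (s := (Finset.univ : Finset I))]
    exact tendsto_finsetSum _ fun i _ =>
      tendsto_const_nhds.div_atTop (Real.tendsto_sqrt_atTop.comp (hli i))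
  refine squeeze_zero' (Eventually.of_forall fun r => norm_nonneg _) ?_ hsum
  have hev : ∀ᶠ r in atTop, ∀ i, 1 ≤ l r i :=
    eventually_all.2 fun i => (hli i).eventually_ge_atTop 1
  filter_upwards [hev] with r hr
  have hτ : ((τ ^ 2 / 2 : ℝ) : ℂ) = ∑ i, ((t r i : ℝ) : ℂ) ^ 2 / 2 := by
    rw [← ht r, EuclideanSpace.norm_sq_eq, Finset.sum_div]
    push_cast
    refine Finset.sum_congr rfl fun i _ => ?_
    rw [Real.norm_eq_abs, ← Complex.ofReal_pow, sq_abs, Complex.ofReal_pow]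
  rw [sub_neg_eq_add, hτ, ← Finset.sum_add_distrib]
  refine (norm_sum_le _ _).trans (Finset.sum_le_sum fun i _ => ?_)
  refine norm_poisson_exponent_add_le (hr i) ?_
  rw [← ht r]
  exact PiLp.norm_apply_le (t r) i

theorem measurable_standardize (l : I → ℝ) : Measurable (standardize l) :=
  measurable_of_countable _

/-- Standardized Poisson vectors with intensities tending to infinity are tight. -/
theorem isTightMeasureSet_standardize [Nonempty I] {Ω : ℕ → Type*} [∀ r, MeasurableSpace (Ω r)]
    {P : ∀ r, Measure (Ω r)} [∀ r, IsProbabilityMeasure (P r)] {l : ℕ → I → ℝ}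
    (hl : ∀ r i, 0 < l r i) (hmin : Tendsto (fun r => ⨅ i, l r i) atTop atTop)
    {Y : ∀ r, Ω r → I → ℕ} (hY : ∀ r, IsPoissonVector (Y r) (l r) (P r)) :
    IsTightMeasureSet (Set.range fun r => (P r).map fun ω => standardize (l r) (Y r ω)) := by
  have : ∀ r, IsProbabilityMeasure ((P r).map fun ω => standardize (l r) (Y r ω)) := fun r =>
    Measure.isProbabilityMeasure_map
      ((measurable_standardize (l r)).comp_aemeasurable (hY r).aemeasurable)
  exact isTightMeasureSet_of_tendsto_charFun
    (f := fun t => Complex.exp (-(‖t‖ ^ 2 / 2 : ℝ))) (by fun_prop)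
    fun t => tendsto_charFun_standardize hl hmin hY fun _ => rfl

/-! ### The chi-squared limit of the normal component -/

theorem chiSquared_eq_map_stdGaussian (K : ℕ) :
    chiSquared K = (stdGaussian (EuclideanSpace ℝ (Fin K))).map fun x => ‖x‖ ^ 2 := by
  rw [← map_pi_eq_stdGaussian, Measure.map_map (by fun_prop) (by fun_prop), chiSquared]
  congr 1
  funext z
  simp [EuclideanSpace.norm_sq_eq]

/-- The squared length of the normal component of the standardized data is asymptotically
chi-squared. -/
theorem tendstoInDistribution_normalSq [Nonempty I] {A : Matrix J I ℝ}
    {Ω : ℕ → Type*} [∀ r, MeasurableSpace (Ω r)]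
    {P : ∀ r, Measure (Ω r)} [∀ r, IsProbabilityMeasure (P r)] {l : ℕ → I → ℝ}
    (hl : ∀ r i, 0 < l r i) (hmin : Tendsto (fun r => ⨅ i, l r i) atTop atTop)
    {Y : ∀ r, Ω r → I → ℕ} (hY : ∀ r, IsPoissonVector (Y r) (l r) (P r)) :
    TendstoInDistribution (fun r ω => normalSq A (l r) (standardize (l r) (Y r ω))) atTop id P
      (chiSquared (Module.finrank ℝ (LinearMap.ker A.mulVecLin))) := by
  set K := Module.finrank ℝ (LinearMap.ker A.mulVecLin) with hK
  -- The dimension of the normal space does not depend on `r`, so arbitrary orthonormal bases give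
  -- coordinates in one fixed space. Being isometric, they pull a frequency `t` back to frequencies
  -- of constant norm `‖t‖`.
  let b : ∀ r, OrthonormalBasis (Fin K) ℝ (tangent A (l r))ᗮ := fun r =>
    (stdOrthonormalBasis ℝ _).reindex (finCongr (finrank_tangent_orthogonal (hl r)))
  let Z : ∀ r, Ω r → EuclideanSpace ℝ (Fin K) := fun r ω =>
    (b r).repr ((tangent A (l r))ᗮ.orthogonalProjectionOnto (standardize (l r) (Y r ω)))
  have hZm : ∀ r, AEMeasurable (Z r) (P r) := fun r =>
    (measurable_of_countable (fun y => (b r).repr ((tangent A (l r))ᗮ.orthogonalProjectionOnto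
      (standardize (l r) y)))).comp_aemeasurable (hY r).aemeasurable
  have hSm : ∀ r, AEMeasurable (fun ω => standardize (l r) (Y r ω)) (P r) := fun r =>
    (measurable_standardize (l r)).comp_aemeasurable (hY r).aemeasurable
  have hZ : TendstoInDistribution Z atTop id P (stdGaussian (EuclideanSpace ℝ (Fin K))) := by
    refine ⟨hZm, aemeasurable_id, ProbabilityMeasure.tendsto_of_tendsto_charFun fun t => ?_⟩
    simp only [ProbabilityMeasure.coe_mk, Measure.map_id, charFun_stdGaussian]
    have h1 := tendsto_charFun_standardize hl hmin hY
      (t := fun r => (((b r).repr.symm t : (tangent A (l r))ᗮ) : EuclideanSpace ℝ I))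
      (τ := ‖t‖) fun r =>
        (Submodule.norm_coe _).trans (LinearIsometryEquiv.norm_map _ _)
    convert! h1 using 2 with r
    · rw [charFun_apply, charFun_apply, integral_map (hZm r) (by fun_prop),
        integral_map (hSm r) (by fun_prop)]
      congr 1
      funext ω
      congr 3
      rw [← LinearIsometryEquiv.inner_map_map (b r).repr.symm, LinearIsometryEquiv.symm_apply_apply,
        Submodule.inner_orthogonalProjectionOnto_eq_of_mem_right]
    · push_cast
      congr 1
      ring
  have h2 := hZ.continuous_comp (g := fun x => ‖x‖ ^ 2) (by fun_prop)
  have hfun : (fun r ω => normalSq A (l r) (standardize (l r) (Y r ω)))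
      = fun r => (fun x : EuclideanSpace ℝ (Fin K) => ‖x‖ ^ 2) ∘ Z r := by
    funext r ω
    simp only [normalSq, Function.comp, Z, LinearIsometryEquiv.norm_map]
    rfl
  rw [hfun]
  refine ⟨h2.forall_aemeasurable, aemeasurable_id, ?_⟩
  have h3 := h2.tendsto
  simp only [Measure.map_id, chiSquared_eq_map_stdGaussian]
  exact h3

/-! ### Slutsky's theorem and conditioning on varying probability spaces -/

section Convergence

variable {Ω Ω' : ℕ → Type*} [∀ r, MeasurableSpace (Ω r)] [∀ r, MeasurableSpace (Ω' r)]
  {P : ∀ r, Measure (Ω r)} [∀ r, IsProbabilityMeasure (P r)]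
  {P' : ∀ r, Measure (Ω' r)} [∀ r, IsProbabilityMeasure (P' r)]
  {S : Type*} [MeasurableSpace S] {μ : Measure S} [IsProbabilityMeasure μ] {Z : S → ℝ}

/-- Convergence in distribution only depends on the laws. -/
theorem tendstoInDistribution_of_map_eq {X : ∀ r, Ω r → ℝ} {X' : ∀ r, Ω' r → ℝ}
    (h : TendstoInDistribution X atTop Z P μ) (hX' : ∀ r, AEMeasurable (X' r) (P' r))
    (hmap : ∀ r, (P' r).map (X' r) = (P r).map (X r)) :
    TendstoInDistribution X' atTop Z P' μ := by
  refine ⟨hX', h.aemeasurable_limit, ?_⟩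
  simp only [hmap]
  exact h.tendsto

/-- Slutsky's theorem for variables on varying probability spaces. -/
theorem tendstoInDistribution_of_sub {X X' : ∀ r, Ω r → ℝ}
    (h : TendstoInDistribution X atTop Z P μ) (hX' : ∀ r, AEMeasurable (X' r) (P r))
    (hsub : ∀ ε > 0, Tendsto (fun r => P r {ω | ε ≤ |X' r ω - X r ω|}) atTop (𝓝 0)) :
    TendstoInDistribution X' atTop Z P μ := by
  have hX := h.forall_aemeasurable
  -- Convergence in measure refers to a single space, so all variables are moved to the product
  -- space. The statement involves only the law of each pair `(X r, X' r)`, so the coupling between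
  -- different `r` is irrelevant.
  have hev : ∀ r, MeasurePreserving (Function.eval r) (Measure.infinitePi P) (P r) :=
    fun r => measurePreserving_eval_infinitePi P r
  have hmap : ∀ (F : ∀ r, Ω r → ℝ), (∀ r, AEMeasurable (F r) (P r)) → ∀ r,
      (Measure.infinitePi P).map (fun ω => F r (ω r)) = (P r).map (F r) := by
    intro F hF r
    have h1 := AEMeasurable.map_map_of_aemeasurable (f := Function.eval r)
      (μ := Measure.infinitePi P) (g := F r) (by rw [(hev r).map_eq]; exact hF r)
      (hev r).aemeasurable
    rw [(hev r).map_eq] at h1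
    exact h1.symm
  have hm : ∀ (F : ∀ r, Ω r → ℝ), (∀ r, AEMeasurable (F r) (P r)) → ∀ r,
      AEMeasurable (fun ω => F r (ω r)) (Measure.infinitePi P) := fun F hF r =>
    (hF r).comp_quasiMeasurePreserving (hev r).quasiMeasurePreserving
  have h1 : TendstoInDistribution (fun r (ω : ∀ r, Ω r) => X r (ω r)) atTop Z
      (fun _ => Measure.infinitePi P) μ :=
    tendstoInDistribution_of_map_eq h (hm X hX) (hmap X hX)
  have h2 := tendstoInDistribution_of_tendstoInMeasure_sub
    (fun r (ω : ∀ r, Ω r) => X' r (ω r)) Z h1 (by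
      rw [tendstoInMeasure_iff_norm]
      intro ε hε
      refine (hsub ε hε).congr fun r => ?_
      have hn : NullMeasurableSet {ω | ε ≤ |X' r ω - X r ω|} (P r) :=
        nullMeasurableSet_le aemeasurable_const ((hX' r).sub (hX r)).norm
      rw [← (hev r).measure_preimage hn]
      simp [Set.preimage, Real.norm_eq_abs]) (hm X' hX')
  exact tendstoInDistribution_of_map_eq h2 hX' fun r => (hmap X' hX' r).symm

/-- Conditioning on events of probability tending to one preserves limits in distribution. -/
theorem tendstoInDistribution_cond {X : ∀ r, Ω r → ℝ} {E : ∀ r, Set (Ω r)}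
    [∀ r, IsProbabilityMeasure ((P r)[|E r])]
    (h : TendstoInDistribution X atTop Z P μ) (hE : ∀ r, NullMeasurableSet (E r) (P r))
    (hlim : Tendsto (fun r => P r (E r)ᶜ) atTop (𝓝 0)) :
    TendstoInDistribution X atTop Z (fun r => (P r)[|E r]) μ := by
  have hX := h.forall_aemeasurable
  have hX' : ∀ r, AEMeasurable (X r) ((P r)[|E r]) := fun r =>
    (hX r).mono_ac (cond_absolutelyContinuous)
  refine ⟨hX', h.aemeasurable_limit, ?_⟩
  refine ProbabilityMeasure.tendsto_iff_forall_integral_tendsto.2 fun f => ?_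
  have h2 := ProbabilityMeasure.tendsto_iff_forall_integral_tendsto.1 h.tendsto f
  simp only [ProbabilityMeasure.coe_mk] at h2 ⊢
  have hc : Tendsto (fun r => (P r).real (E r)ᶜ) atTop (𝓝 0) := by
    have := (ENNReal.tendsto_toReal ENNReal.zero_ne_top).comp hlim
    rwa [ENNReal.toReal_zero] at this
  have hr : Tendsto (fun r => (P r).real (E r)) atTop (𝓝 1) := by
    have : (fun r => (P r).real (E r)) = fun r => 1 - (P r).real (E r)ᶜ := by
      funext r
      rw [probReal_compl_eq_one_sub₀ (hE r)]
      ring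
    rw [this]
    simpa using hc.const_sub 1
  have hint : ∀ r, Integrable (fun ω => f (X r ω)) (P r) := fun r =>
    Integrable.of_bound (f.continuous.measurable.comp_aemeasurable (hX r)).aestronglyMeasurable
      ‖f‖ (Eventually.of_forall fun ω => f.norm_coe_le_norm _)
  have hcompl : Tendsto (fun r => ∫ ω in (E r)ᶜ, f (X r ω) ∂(P r)) atTop (𝓝 0) := by
    refine squeeze_zero_norm (fun r => norm_setIntegral_le_of_norm_le_const (C := ‖f‖)
      (measure_lt_top _ _) fun ω _ => f.norm_coe_le_norm _) ?_
    simpa using hc.const_mul ‖f‖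
  -- The conditional expectation is `P(E)⁻¹` times the full expectation minus the integral over the
  -- complement of `E`, which vanishes in the limit.
  have h3 := (hr.inv₀ one_ne_zero).mul (h2.sub hcompl)
  rw [inv_one, one_mul, sub_zero] at h3
  refine h3.congr fun r => ?_
  rw [integral_map (hX r) f.continuous.aestronglyMeasurable,
    integral_map (hX' r) f.continuous.aestronglyMeasurable, ProbabilityTheory.cond,
    integral_smul_measure, ← integral_add_compl₀ (hE r) (hint r), add_sub_cancel_right,
    ENNReal.toReal_inv, smul_eq_mul]
  rfl

end Convergence

/-! ### Probability of existence and of closeness to the normal component -/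

/-- Every set of data containing the constant `1` has positive probability. -/
theorem IsPoissonVector.measure_preimage_pos {Ω : Type*} [MeasurableSpace Ω] {Y : Ω → I → ℕ}
    {l : I → ℝ} {P : Measure Ω} (h : IsPoissonVector Y l P) (hl : ∀ i, 0 < l i)
    {s : Set (I → ℕ)} (hs : (fun _ => 1) ∈ s) : P (Y ⁻¹' s) ≠ 0 := by
  have h1 : P (⋂ i ∈ Finset.univ, (fun ω => Y ω i) ⁻¹' {1})
      = ∏ i, P ((fun ω => Y ω i) ⁻¹' {1}) :=
    h.indep.measure_inter_preimage_eq_mul Finset.univ fun _ _ => measurableSet_singleton 1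
  have h2 : P (⋂ i ∈ Finset.univ, (fun ω => Y ω i) ⁻¹' {1}) ≠ 0 := by
    rw [h1, Finset.prod_ne_zero_iff]
    intro i _
    rw [← Measure.map_apply_of_aemeasurable (h.hasLaw i).aemeasurable (measurableSet_singleton 1),
      (h.hasLaw i).map_eq]
    intro h0
    have := poissonMeasure_real_singleton_pos 1 (Real.toNNReal_pos.2 (hl i))
    rw [Measure.real, h0] at this
    simp at this
  refine fun h0 => h2 (measure_mono_null (fun ω hω => ?_) h0)
  simp only [Finset.mem_univ, Set.iInter_true, Set.mem_iInter, Set.mem_preimage,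
    Set.mem_singleton_iff] at hω
  have : Y ω = fun _ => 1 := funext hω
  rwa [Set.mem_preimage, this]

/-- With probability tending to one the maximum likelihood estimate exists and both statistics are
close to `normalSq`. -/
theorem tendsto_measure_not_near [Nonempty I] {A : Matrix J I ℝ}
    {Ω : ℕ → Type*} [∀ r, MeasurableSpace (Ω r)]
    {P : ∀ r, Measure (Ω r)} [∀ r, IsProbabilityMeasure (P r)] {l : ℕ → I → ℝ}
    (hl : ∀ r, l r ∈ model A) (hmin : Tendsto (fun r => ⨅ i, l r i) atTop atTop)
    {Y : ∀ r, Ω r → I → ℕ} (hY : ∀ r, IsPoissonVector (Y r) (l r) (P r)) {ε : ℝ} (hε : 0 < ε) :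
    Tendsto (fun r => P r {ω | ¬ (Y r ω ∈ mleExists A ∧
      |pearson (fun i => (Y r ω i : ℝ)) (mle A (Y r ω))
        - normalSq A (l r) (standardize (l r) (Y r ω))| < ε ∧
      |bregman (fun i => (Y r ω i : ℝ)) (mle A (Y r ω))
        - normalSq A (l r) (standardize (l r) (Y r ω))| < ε)}) atTop (𝓝 0) := by
  rw [ENNReal.tendsto_nhds_zero]
  intro η hη
  -- Tightness gives a radius `R` valid for all `r` up to probability `η`. Then `δ` is chosen from
  -- `R` and `ε` alone, and `R ≤ δ √l` holds eventually.
  obtain ⟨K, hK, hKη⟩ := isTightMeasureSet_iff_exists_isCompact_measure_compl_le.1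
    (isTightMeasureSet_standardize (fun r => (hl r).1) hmin hY) η hη
  obtain ⟨R, hR, hKR⟩ := hK.isBounded.subset_closedBall_lt 0 0
  obtain ⟨δ, hδ0, hδ, hδε⟩ : ∃ δ : ℝ, 0 < δ ∧ δ ≤ 1 / 50 ∧ 5000 * R ^ 2 * δ < ε := by
    refine ⟨min (1 / 50) (ε / (10000 * R ^ 2)), by positivity, min_le_left _ _, ?_⟩
    calc 5000 * R ^ 2 * min (1 / 50) (ε / (10000 * R ^ 2))
        ≤ 5000 * R ^ 2 * (ε / (10000 * R ^ 2)) := by gcongr; exact min_le_right _ _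
      _ = ε / 2 := by field_simp; norm_num
      _ < ε := half_lt_self hε
  have hev : ∀ᶠ r in atTop, ∀ i, R ≤ δ * Real.sqrt (l r i) := by
    refine eventually_all.2 fun i => ?_
    have hli : Tendsto (fun r => l r i) atTop atTop :=
      tendsto_atTop_mono (fun r => ciInf_le (Set.finite_range _).bddBelow i) hmin
    exact ((Real.tendsto_sqrt_atTop.comp hli).const_mul_atTop hδ0).eventually_ge_atTop R
  filter_upwards [hev] with r hr
  refine le_trans ?_ (hKη _ ⟨r, rfl⟩)
  have hS : AEMeasurable (fun ω => standardize (l r) (Y r ω)) (P r) :=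
    (measurable_standardize (l r)).comp_aemeasurable (hY r).aemeasurable
  beta_reduce
  rw [Measure.map_apply_of_aemeasurable hS hK.measurableSet.compl]
  refine measure_mono fun ω hω hωK => hω ?_
  have hn : ‖standardize (l r) (Y r ω)‖ ≤ R := by simpa using hKR hωK
  obtain ⟨h1, h2, h3⟩ := statistics_near_normalSq (hl r) hR hδ0 hδ hn hr
  have h4 : 0 < R ^ 2 * δ := by positivity
  exact ⟨h1, by linarith, by linarith⟩

theorem augmentedMLE_of_mem {A : Matrix J I ℝ} {y : I → ℕ} (hy : y ∈ mleExists A) :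
    augmentedMLE A y = mle A y := if_pos hy

end RelationalModel

/-! ### The four limit laws -/

theorem mainTheorem3 {I J : Type*} [Fintype I] [Nonempty I] [Fintype J]
    (A : Matrix J I ℝ) (hA : RelationalModel.IsDesignMatrix A)
    {Ω : ℕ → Type*} [∀ r, MeasurableSpace (Ω r)]
    (P : ∀ r, Measure (Ω r)) [∀ r, IsProbabilityMeasure (P r)]
    (l₀ : ℕ → I → ℝ) (hl₀ : ∀ r, l₀ r ∈ RelationalModel.model A)
    (hmin : Tendsto (fun r => ⨅ i, l₀ r i) atTop atTop)
    (Y : ∀ r, Ω r → I → ℕ) (hY : ∀ r, RelationalModel.IsPoissonVector (Y r) (l₀ r) (P r)) :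
    -- the conditional measures given existence of the MLE are probability measures
    (∃ _ : ∀ r, IsProbabilityMeasure ((P r)[|Y r ⁻¹' RelationalModel.mleExists A]),
      TendstoInDistribution
        (fun r ω => RelationalModel.pearson (fun i => (Y r ω i : ℝ))
          (RelationalModel.mle A (Y r ω)))
        atTop id (fun r => (P r)[|Y r ⁻¹' RelationalModel.mleExists A])
        (RelationalModel.chiSquared (Module.finrank ℝ (LinearMap.ker A.mulVecLin))) ∧
      TendstoInDistribution
        (fun r ω => RelationalModel.bregman (fun i => (Y r ω i : ℝ))
          (RelationalModel.mle A (Y r ω)))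
        atTop id (fun r => (P r)[|Y r ⁻¹' RelationalModel.mleExists A])
        (RelationalModel.chiSquared (Module.finrank ℝ (LinearMap.ker A.mulVecLin)))) ∧
    TendstoInDistribution
      (fun r ω => RelationalModel.pearson (fun i => (Y r ω i : ℝ))
        (RelationalModel.augmentedMLE A (Y r ω)))
      atTop id P
      (RelationalModel.chiSquared (Module.finrank ℝ (LinearMap.ker A.mulVecLin))) ∧
    TendstoInDistribution
      (fun r ω => RelationalModel.bregman (fun i => (Y r ω i : ℝ))
        (RelationalModel.augmentedMLE A (Y r ω)))
      atTop id P
      (RelationalModel.chiSquared (Module.finrank ℝ (LinearMap.ker A.mulVecLin))) := by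
  have hq := RelationalModel.tendstoInDistribution_normalSq (A := A) (fun r => (hl₀ r).1) hmin hY
  have hmeas : ∀ (F : (I → ℕ) → ℝ) r, AEMeasurable (fun ω => F (Y r ω)) (P r) := fun F r =>
    (measurable_of_countable F).comp_aemeasurable (hY r).aemeasurable
  have hnear := fun ε (hε : (0 : ℝ) < ε) =>
    RelationalModel.tendsto_measure_not_near hl₀ hmin hY hε
  have hprob : ∀ r, IsProbabilityMeasure ((P r)[|Y r ⁻¹' RelationalModel.mleExists A]) := fun r =>
    cond_isProbabilityMeasure
      ((hY r).measure_preimage_pos (hl₀ r).1 (RelationalModel.one_mem_mleExists A))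
  have hEm : ∀ r, NullMeasurableSet (Y r ⁻¹' RelationalModel.mleExists A) (P r) := fun r =>
    (hY r).aemeasurable.nullMeasurableSet_preimage (Set.to_countable _).measurableSet
  -- Only the existence clause matters here, so the tolerance `1` is arbitrary.
  have hE : Tendsto (fun r => P r (Y r ⁻¹' RelationalModel.mleExists A)ᶜ) atTop (𝓝 0) :=
    tendsto_of_tendsto_of_tendsto_of_le_of_le tendsto_const_nhds (hnear 1 one_pos)
      (fun _ => zero_le) fun r => measure_mono fun ω hω h => hω h.1
  have hpear : TendstoInDistribution (fun r ω => RelationalModel.pearson (fun i => (Y r ω i : ℝ))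
      (RelationalModel.augmentedMLE A (Y r ω))) atTop id P
      (RelationalModel.chiSquared (Module.finrank ℝ (LinearMap.ker A.mulVecLin))) := by
    refine RelationalModel.tendstoInDistribution_of_sub hq (hmeas fun y =>
      RelationalModel.pearson (fun i => (y i : ℝ)) (RelationalModel.augmentedMLE A y)) ?_
    -- On the good event the augmented MLE is the MLE, so its value elsewhere has no influence on
    -- the limit.
    refine fun ε hε => tendsto_of_tendsto_of_tendsto_of_le_of_le tendsto_const_nhds (hnear ε hε)
      (fun _ => zero_le) fun r => measure_mono fun ω hω h => ?_
    rw [Set.mem_ofPred_eq, RelationalModel.augmentedMLE_of_mem h.1] at hω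
    exact hω.not_gt h.2.1
  have hbreg : TendstoInDistribution (fun r ω => RelationalModel.bregman (fun i => (Y r ω i : ℝ))
      (RelationalModel.augmentedMLE A (Y r ω))) atTop id P
      (RelationalModel.chiSquared (Module.finrank ℝ (LinearMap.ker A.mulVecLin))) := by
    refine RelationalModel.tendstoInDistribution_of_sub hq (hmeas fun y =>
      RelationalModel.bregman (fun i => (y i : ℝ)) (RelationalModel.augmentedMLE A y)) ?_
    refine fun ε hε => tendsto_of_tendsto_of_tendsto_of_le_of_le tendsto_const_nhds (hnear ε hε)
      (fun _ => zero_le) fun r => measure_mono fun ω hω h => ?_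
    rw [Set.mem_ofPred_eq, RelationalModel.augmentedMLE_of_mem h.1] at hω
    exact hω.not_gt h.2.2
  -- The conditional measure lives on the event where both estimates agree, so the conditional
  -- limits follow from those of the augmented statistics.
  have hae : ∀ r, ∀ᵐ ω ∂(P r)[|Y r ⁻¹' RelationalModel.mleExists A],
      RelationalModel.augmentedMLE A (Y r ω) = RelationalModel.mle A (Y r ω) := by
    intro r
    have h1 := ae_restrict_mem₀ (hEm r)
    exact (Measure.ae_smul_measure h1 _).mono fun ω hω => RelationalModel.augmentedMLE_of_mem hω
  refine ⟨⟨hprob, ?_, ?_⟩, hpear, hbreg⟩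
  · exact (RelationalModel.tendstoInDistribution_cond hpear hEm hE).congr
      (fun r => (hae r).mono fun ω hω => by simp only [hω]) (ae_eq_refl _)
  · exact (RelationalModel.tendstoInDistribution_cond hbreg hEm hE).congr
      (fun r => (hae r).mono fun ω hω => by simp only [hω]) (ae_eq_refl _)
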